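/- Let $G$ be a locally compact (Hausdorff) Abelian group with Haar measure $dx$, and let $w\colon G\to(0,\infty)$ be a Borel measurable weight, i.e. $w(xy)\le w(x)w(y)$ for all $x,y\in G$; in the case that $G$ is the trivial group $\{e\}$, assume also the usual normalization $w(e)=1$. Let $L^1(G,w)$ be the Banach space of (classes of) Borel functions $f\colon G\to\mathbb C$ with $\|f\|_{1,w}=\int_G|f(x)|\,w(x)\,dx<\infty$, with the convolution product $(f\star g)(x)=\int_G f(y)g(y^{-1}x)\,dy$, and let $L^1(G)=L^1(G,1)$, with norm $\|\cdot\|_1$. Let $\widehat{G_w}$ be the set of all nonzero Borel measurable multiplicative functions $\chi\colon G\to\mathbb C$ such that $\chi/w$ is bounded, with the Gelfand topology, and let $\widehat G$ be the dual group of $G$. The Gelfand maps $\Gamma_w\colon L^1(G,w)\to C_0(\widehat{G_w})$ and $\Gamma\colon L^1(G)\to C_0(\widehat G)$ are given by $f\mapsto\hat f$, $\hat f(\chi)=\int_G f(x)\overline{\chi(x)}\,dx$, and $C_0$ carries the supremum norm. Then the following are equivalent: 1. the Gelfand map $\Gamma_w\colon L^1(G,w)\to C_0(\widehat{G_w})$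 is an isometry; 2. the Gelfand map $\Gamma\colon L^1(G)\to C_0(\widehat G)$ is an isometry; 3. $(L^1(G,w),\|\cdot\|_{1,w})$ with convolution is a $C^*$-algebra (for some involution); 4. $(L^1(G),\|\cdot\|_1)$ with convolution is a $C^*$-algebra (for some involution); 5. $G$ is the trivial group. -/

import Mathlib

open MeasureTheory ComplexConjugate
open scoped ENNReal BoundedContinuousFunction

universe u

/-- A (Borel measurable) weight on a group: a strictly positive, Borel measurable,
submultiplicative function. -/
structure IsWeight {G : Type u} [Group G] [MeasurableSpace G] (w : G → ℝ) : Prop where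
  pos : ∀ x, 0 < w x
  measurable : Measurable w
  submul : ∀ x y, w (x * y) ≤ w x * w y

/-- The measure `w(x) dx`. -/
noncomputable def weightedMeasure {G : Type u} [MeasurableSpace G] (μ : Measure G) (w : G → ℝ) :
    Measure G :=
  μ.withDensity fun x => ENNReal.ofReal (w x)

/-- The Banach space `L¹(G, w)`, with norm `‖f‖ = ∫ |f(x)| w(x) dx`. Since `w > 0`, its elements are
classes of functions modulo equality `μ`-almost everywhere. -/
noncomputable abbrev WeightedL1 {G : Type u} [MeasurableSpace G] (μ : Measure G) (w : G → ℝ) :=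
  Lp ℂ 1 (weightedMeasure μ w)

/-- The convolution `(f ⋆ g)(x) = ∫ f(y) g(y⁻¹ x) dy`. -/
noncomputable def groupConv {G : Type u} [Group G] [MeasurableSpace G] (μ : Measure G)
    (f g : G → ℂ) (x : G) : ℂ :=
  ∫ y, f y * g (y⁻¹ * x) ∂μ

/-- The Banach space `L¹(ν)`, with its own norm and with convolution (with respect to the Haar
measure `μ`) as product, is a C⋆-algebra: there are a C⋆-algebra `B` and a surjective linear
isometry `L¹(ν) → B` that carries convolution to the product of `B`. Equivalently, convolution and
some involution make `L¹(ν)` into a C⋆-algebra. -/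
def IsCStarUnderConv {G : Type u} [Group G] [MeasurableSpace G] (μ ν : Measure G) : Prop :=
  ∃ (B : Type u) (_ : NonUnitalCStarAlgebra B) (e : Lp ℂ 1 ν ≃ₗᵢ[ℂ] B),
    ∀ f g : Lp ℂ 1 ν, e.symm (e f * e g) =ᵐ[μ] groupConv μ f g

/-- The set `Ĝ_w` of all Borel measurable multiplicative functions `χ : G → ℂ` (not identically
zero, so `χ(e) = 1`) such that `χ / w` is bounded. The Haar measure `μ` plays no part in this set;
it is an argument because the Gelfand topology below is written with it. -/
@[nolint unusedArguments]
def WeightedDual {G : Type u} [Group G] [MeasurableSpace G] (_μ : Measure G) (w : G → ℝ) :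
    Type u :=
  {χ : G →* ℂ // Measurable χ ∧ ∃ C : ℝ, ∀ x, ‖χ x / w x‖ ≤ C}

/-- The Fourier transform `∫ f(x) conj(χ(x)) dx` of `f` at `χ`. -/
noncomputable def fourierAt {G : Type u} [MeasurableSpace G] (μ : Measure G)
    (f χ : G → ℂ) : ℂ :=
  ∫ x, conj (χ x) * f x ∂μ

section weighted

variable {G : Type u} [CommGroup G] [MeasurableSpace G]

/-- The Gelfand topology on `Ĝ_w`: the coarsest topology for which `χ ↦ ∫ f(x) conj(χ(x)) dx` is
continuous for every `f ∈ L¹(G, w)`. -/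
noncomputable instance gelfandTopology (μ : Measure G) (w : G → ℝ) :
    TopologicalSpace (WeightedDual μ w) :=
  TopologicalSpace.induced
    (fun (χ : WeightedDual μ w) (f : WeightedL1 μ w) => fourierAt μ f χ.1) inferInstance

theorem WeightedDual.norm_le {μ : Measure G} {w : G → ℝ} (hw : IsWeight w)
    (χ : WeightedDual μ w) (x : G) :
    ‖χ.1 x‖ ≤ w x := by
  obtain ⟨C, hC⟩ := χ.2.2
  have hwn : ∀ n : ℕ, w (x ^ (n + 1)) ≤ w x ^ (n + 1) := by
    intro n
    induction n with
    | zero => simp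
    | succ n ih =>
      rw [pow_succ, pow_succ (w x)]
      exact (hw.submul _ _).trans (mul_le_mul_of_nonneg_right ih (hw.pos x).le)
  have key : ∀ n : ℕ, (‖χ.1 x‖ / w x) ^ (n + 1) ≤ C := by
    intro n
    have h1 := hC (x ^ (n + 1))
    rw [norm_div, map_pow, norm_pow, Complex.norm_real, Real.norm_of_nonneg (hw.pos _).le] at h1
    rw [div_pow]
    exact le_trans (div_le_div_of_nonneg_left (by positivity) (hw.pos _) (hwn n)) h1
  by_contra h
  have h1 : 1 < ‖χ.1 x‖ / w x := by
    rw [lt_div_iff₀ (hw.pos x), one_mul]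
    exact not_le.mp h
  obtain ⟨n, hn⟩ := pow_unbounded_of_one_lt C h1
  have h2 := pow_le_pow_right₀ h1.le (Nat.le_succ n)
  exact absurd (key n) (not_le.mpr (hn.trans_le h2))

theorem norm_fourierAt_le {μ : Measure G} {w : G → ℝ} (hw : IsWeight w) (χ : WeightedDual μ w)
    (f : WeightedL1 μ w) : ‖fourierAt μ f χ.1‖ ≤ ‖f‖ := by
  have hm : Measurable fun x => ENNReal.ofReal (w x) := hw.measurable.ennreal_ofReal
  have h1 : ‖f‖ = ∫ x, ‖f x‖ ∂(weightedMeasure μ w) := L1.norm_eq_integral_norm f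
  have h2 : ∫ x, ‖f x‖ ∂(weightedMeasure μ w) = ∫ x, w x * ‖f x‖ ∂μ := by
    unfold weightedMeasure
    rw [integral_withDensity_eq_integral_toReal_smul hm (by simp)]
    exact integral_congr_ae (.of_forall fun x => by
      simp [ENNReal.toReal_ofReal (hw.pos x).le])
  have h3 : Integrable (fun x => w x * ‖f x‖) μ := by
    have h4 : Integrable (fun x => ‖f x‖) (weightedMeasure μ w) := (L1.integrable_coeFn f).norm
    unfold weightedMeasure at h4
    rw [integrable_withDensity_iff_integrable_smul' hm (by simp)] at h4
    refine h4.congr (.of_forall fun x => ?_)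
    change (ENNReal.ofReal (w x)).toReal • ‖f x‖ = w x * ‖f x‖
    rw [ENNReal.toReal_ofReal (hw.pos x).le, smul_eq_mul]
  rw [h1, h2]
  refine norm_integral_le_of_norm_le h3 (.of_forall fun x => ?_)
  rw [norm_mul, RCLike.norm_conj]
  exact mul_le_mul_of_nonneg_right (χ.norm_le hw x) (norm_nonneg _)

/-- The Gelfand map `Γ_w` of `L¹(G, w)`, `(Γ_w f)(χ) = ∫ f(x) conj(χ(x)) dx` for `χ ∈ Ĝ_w`. Its
values are regarded as bounded continuous functions on `Ĝ_w`, with the supremum norm, which is the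
norm of `C₀(Ĝ_w)`. -/
noncomputable def weightedGelfandMap (μ : Measure G) (w : G → ℝ) (hw : IsWeight w)
    (f : WeightedL1 μ w) : WeightedDual μ w →ᵇ ℂ :=
  BoundedContinuousFunction.ofNormedAddCommGroup (fun χ => fourierAt μ f χ.1)
    ((continuous_apply f).comp continuous_induced_dom :
      Continuous ((fun p : WeightedL1 μ w → ℂ => p f) ∘ fun (χ : WeightedDual μ w)
        (f : WeightedL1 μ w) => fourierAt μ f χ.1)) ‖f‖
    (fun χ => norm_fourierAt_le hw χ f)

end weighted

set_option linter.unusedSectionVars false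

section unweighted

variable {G : Type u} [CommGroup G] [TopologicalSpace G] [IsTopologicalGroup G]
  [LocallyCompactSpace G] [T2Space G] [MeasurableSpace G] [BorelSpace G]

/-- A character `γ ∈ Ĝ` as a complex-valued function. -/
noncomputable def dualFun (γ : PontryaginDual G) (x : G) : ℂ := ((γ : G →ₜ* Circle) x : ℂ)

theorem continuous_dualFun_uncurry :
    Continuous (Function.uncurry (dualFun : PontryaginDual G → G → ℂ)) := by
  have h : Continuous fun p : C(G, Circle) × G => p.1 p.2 := continuous_eval
  have h2 : Continuous fun p : PontryaginDual G × G =>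
      (ContinuousMonoidHom.toContinuousMap (p.1 : G →ₜ* Circle), p.2) :=
    ((ContinuousMonoidHom.isInducing_toContinuousMap G Circle).continuous.comp
      continuous_fst).prodMk continuous_snd
  exact continuous_subtype_val.comp (h.comp h2)

theorem norm_dualFun (γ : PontryaginDual G) (x : G) : ‖dualFun γ x‖ = 1 := Circle.norm_coe _

theorem continuous_dualFun (γ : PontryaginDual G) : Continuous (dualFun γ) :=
  continuous_dualFun_uncurry.comp (Continuous.prodMk_right γ)

theorem integrable_conj_dualFun_mul {μ : Measure G} {f : G → ℂ} (hf : Integrable f μ)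
    (γ : PontryaginDual G) : Integrable (fun x => conj (dualFun γ x) * f x) μ :=
  hf.bdd_mul (c := 1)
    (Complex.continuous_conj.comp (continuous_dualFun γ)).measurable.aestronglyMeasurable
    (.of_forall fun x => by rw [RCLike.norm_conj, norm_dualFun])

theorem norm_fourierAt_dual_le (μ : Measure G) (f : G → ℂ) (γ : PontryaginDual G) :
    ‖fourierAt μ f (dualFun γ)‖ ≤ ∫ x, ‖f x‖ ∂μ := by
  refine (norm_integral_le_integral_norm _).trans (le_of_eq (integral_congr_ae ?_))
  exact .of_forall fun x => by
    dsimp only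
    rw [norm_mul, RCLike.norm_conj, norm_dualFun, one_mul]

theorem continuous_fourierAt_indicator (μ : Measure G) [μ.Regular] (c : ℂ) {s : Set G}
    (hs : IsCompact s) :
    Continuous fun γ : PontryaginDual G =>
      fourierAt μ (s.indicator fun _ => c) (dualFun γ) := by
  have hsm : MeasurableSet s := hs.isClosed.measurableSet
  have h : (fun γ : PontryaginDual G => fourierAt μ (s.indicator fun _ => c) (dualFun γ)) =
      fun γ => ∫ x : s, conj (dualFun γ (x : G)) * c ∂(μ.comap (Subtype.val : s → G)) := by
    funext γ
    rw [integral_subtype_comap hsm fun x => conj (dualFun γ x) * c, ← integral_indicator hsm]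
    unfold fourierAt
    congr 1
    funext x
    by_cases hx : x ∈ s <;> simp [hx]
  have : CompactSpace s := isCompact_iff_compactSpace.mp hs
  have : IsFiniteMeasure (μ.comap (Subtype.val : s → G)) := by
    refine ⟨?_⟩
    rw [comap_subtype_coe_apply hsm, Set.image_univ, Subtype.range_val]
    exact hs.measure_lt_top
  rw [h, ← continuousOn_univ]
  refine continuousOn_integral_of_compact_support (k := Set.univ) isCompact_univ ?_ ?_
  · have h3 : Continuous fun p : PontryaginDual G × s => (p.1, (p.2 : G)) :=
      continuous_fst.prodMk (continuous_subtype_val.comp continuous_snd)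
    exact ((Complex.continuous_conj.comp (continuous_dualFun_uncurry.comp h3)).mul
      continuous_const).continuousOn
  · intro γ x _ hx
    exact absurd (Set.mem_univ x) hx

theorem continuous_fourierAt (μ : Measure G) [μ.Regular] (f : Lp ℂ 1 μ) :
    Continuous fun γ : PontryaginDual G => fourierAt μ f (dualFun γ) := by
  have hf : Integrable f μ := L1.integrable_coeFn f
  have hsub : ∀ {f g : G → ℂ}, Integrable f μ → Integrable g μ → ∀ γ : PontryaginDual G,
      ‖fourierAt μ f (dualFun γ) - fourierAt μ g (dualFun γ)‖ ≤ ∫ x, ‖(f - g) x‖ ∂μ := by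
    intro f g hf hg γ
    have h : fourierAt μ f (dualFun γ) - fourierAt μ g (dualFun γ) =
        fourierAt μ (f - g) (dualFun γ) := by
      unfold fourierAt
      rw [← integral_sub (integrable_conj_dualFun_mul hf γ) (integrable_conj_dualFun_mul hg γ)]
      simp only [mul_sub, Pi.sub_apply]
    rw [h]
    exact norm_fourierAt_dual_le μ _ γ
  have happ : ∀ ε : ℝ, 0 < ε → ∃ g : G → ℂ, eLpNorm ((f : G → ℂ) - g) 1 μ ≤ ENNReal.ofReal (ε / 2) ∧
      (Integrable g μ ∧ Continuous fun γ : PontryaginDual G => fourierAt μ g (dualFun γ)) := by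
    intro ε hε
    refine (memLp_one_iff_integrable.mpr hf).induction_dense ENNReal.one_ne_top
      (fun g => Integrable g μ ∧ Continuous fun γ : PontryaginDual G => fourierAt μ g (dualFun γ))
      ?_ ?_ (fun g hg => hg.1.aestronglyMeasurable) (by simpa using hε)
    · intro c t ht htμ δ hδ
      obtain ⟨η, hη, hη2⟩ := exists_eLpNorm_indicator_le (μ := μ) ENNReal.one_ne_top c hδ
      obtain ⟨s, hst, hs, hsc, hμs⟩ :=
        ht.exists_isCompact_isClosed_sdiff_lt htμ.ne (ENNReal.coe_pos.2 hη).ne'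
      refine ⟨s.indicator fun _ => c, ?_, ?_, continuous_fourierAt_indicator μ c hs⟩
      · rw [← eLpNorm_neg, neg_sub, ← Set.indicator_sdiff hst]
        exact hη2 _ hμs.le
      · exact (integrable_indicator_iff hsc.measurableSet).mpr
          (integrableOn_const hs.measure_ne_top)
    · rintro g h ⟨hg, hgc⟩ ⟨hh, hhc⟩
      refine ⟨hg.add hh, ?_⟩
      have : (fun γ : PontryaginDual G => fourierAt μ (g + h) (dualFun γ)) =
          fun γ => fourierAt μ g (dualFun γ) + fourierAt μ h (dualFun γ) := by
        funext γ
        unfold fourierAt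
        rw [← integral_add (integrable_conj_dualFun_mul hg γ) (integrable_conj_dualFun_mul hh γ)]
        simp only [mul_add, Pi.add_apply]
      rw [this]
      exact hgc.add hhc
  refine continuous_of_uniform_approx_of_continuous fun V hV => ?_
  obtain ⟨ε, hε, hεV⟩ := Metric.mem_uniformity_dist.mp hV
  obtain ⟨g, hfg, hg, hgc⟩ := happ ε hε
  refine ⟨_, hgc, fun γ => hεV ?_⟩
  rw [dist_eq_norm]
  refine (hsub hf hg γ).trans_lt (lt_of_le_of_lt ?_ (half_lt_self hε))
  rw [integral_norm_eq_lintegral_enorm (hf.sub hg).aestronglyMeasurable,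
    ← eLpNorm_one_eq_lintegral_enorm]
  exact ENNReal.toReal_le_of_le_ofReal (half_pos hε).le hfg

/-- The Gelfand map `Γ` of `L¹(G)`, `(Γ f)(γ) = ∫ f(x) conj(γ(x)) dx` for `γ` in the dual group
`Ĝ`. Its values are regarded as bounded continuous functions on `Ĝ`, with the supremum norm, which
is the norm of `C₀(Ĝ)`. -/
noncomputable def gelfandMap (μ : Measure G) [μ.Regular] (f : Lp ℂ 1 μ) : PontryaginDual G →ᵇ ℂ :=
  BoundedContinuousFunction.ofNormedAddCommGroup (fun γ => fourierAt μ f (dualFun γ))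
    (continuous_fourierAt μ f) ‖f‖ 
    (fun γ => (norm_fourierAt_dual_le μ f γ).trans_eq (L1.norm_eq_integral_norm f).symm)

end unweighted

open scoped Topology Pointwise

/-! ### Automatic regularity of Borel weights and characters -/

section general

variable {G : Type u} [CommGroup G] [TopologicalSpace G] [IsTopologicalGroup G]
  [LocallyCompactSpace G] [T2Space G] [MeasurableSpace G] [BorelSpace G]

/-! Each of the four analytic conditions forces `‖f‖ ^ 2 ≤ ‖f ⋆ f‖` for `f ∈ C_c(G)`. For an
isometric Gelfand map this follows from `|f̂(χ)| ^ 2 = |(f ⋆ f)^(χ)| ≤ ‖f ⋆ f‖` by taking the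
supremum over `χ`; in a C⋆-algebra with commutative product every element is normal, so `‖b * b‖ =
‖b‖ ^ 2`.

On a nontrivial `G` this inequality fails (`exists_integral_norm_groupConv_lt`). If `f(y) f(y⁻¹)`
takes both signs, cancellation makes `|f ⋆ f| < |f| ⋆ |f|` at `1`, hence nearby by continuity, while
`|f| ⋆ |f|` has norm at most `‖f‖ ^ 2`.

Working in `C_c(G)` allows Fubini without σ-finiteness, but requires `w` to be locally integrable
and the elements of `Ĝ_w` to be continuous. Both are only assumed Borel, and Steinhaus supplies the
rest. Conversely, over the trivial group integration identifies `L¹` with `ℂ`. -/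

/-- A consequence of the Steinhaus theorem: in a countable measurable cover of `G`, some member `A`
has the property that `A / A` is a neighbourhood of `1`. -/
theorem exists_div_mem_nhds_one_of_iUnion_eq_univ (μ : Measure G) [μ.IsHaarMeasure] [μ.Regular]
    {ι : Type*} [Countable ι] {A : ι → Set G} (hA : ∀ i, MeasurableSet (A i))
    (hU : ⋃ i, A i = Set.univ) : ∃ i, A i / A i ∈ 𝓝 (1 : G) := by
  -- Cutting down to a compact neighbourhood gives a piece of positive and finite measure, as
  -- Steinhaus requires.
  obtain ⟨K, hK, hK1⟩ := exists_compact_mem_nhds (1 : G)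
  have hne : (interior K).Nonempty := ⟨1, mem_interior_iff_mem_nhds.mpr hK1⟩
  obtain ⟨i, hi⟩ : ∃ i, 0 < μ (interior K ∩ A i) := by
    by_contra! h
    simp_rw [nonpos_iff_eq_zero, ← measure_iUnion_null_iff, ← Set.inter_iUnion, hU,
      Set.inter_univ] at h
    exact h.not_gt (isOpen_interior.measure_pos _ hne)
  refine ⟨i, Filter.mem_of_superset (Measure.div_mem_nhds_one_of_haar_pos_ne_top μ _
    (isOpen_interior.measurableSet.inter (hA i)) hi ?_)
    (Set.div_subset_div Set.inter_subset_right Set.inter_subset_right)⟩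
  exact ((measure_mono (Set.inter_subset_left.trans interior_subset)).trans_lt
    hK.measure_lt_top).ne

/-- The sets where `w x` and `w x⁻¹` are both at most `n` cover `G`; on the quotient set of one of
them, submultiplicativity bounds `w` by `n * n`. -/
theorem IsWeight.exists_le_nhds_one (μ : Measure G) [μ.IsHaarMeasure] [μ.Regular] {w : G → ℝ}
    (hw : IsWeight w) : ∃ C : ℝ, ∀ᶠ x in 𝓝 (1 : G), w x ≤ C := by
  obtain ⟨n, hn⟩ := exists_div_mem_nhds_one_of_iUnion_eq_univ μ
    (A := fun n : ℕ => {x | w x ≤ n} ∩ {x | w x⁻¹ ≤ n})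
    (fun n => (measurableSet_le hw.measurable measurable_const).inter
      (measurableSet_le (hw.measurable.comp measurable_inv) measurable_const))
    (by
      refine Set.eq_univ_of_forall fun x => Set.mem_iUnion.mpr ?_
      obtain ⟨n, hn⟩ := exists_nat_ge (max (w x) (w x⁻¹))
      exact ⟨n, (le_max_left _ _).trans hn, (le_max_right _ _).trans hn⟩)
  refine ⟨n * n, Filter.mem_of_superset hn ?_⟩
  rintro _ ⟨x, hx, y, hy, rfl⟩
  simp only [Set.mem_ofPred_eq, div_eq_mul_inv]
  exact (hw.submul _ _).trans (mul_le_mul hx.1 hy.2 (hw.pos _).le (Nat.cast_nonneg _))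

theorem IsWeight.isFiniteMeasureOnCompacts (μ : Measure G) [μ.IsHaarMeasure] [μ.Regular]
    {w : G → ℝ} (hw : IsWeight w) : IsFiniteMeasureOnCompacts (weightedMeasure μ w) := by
  obtain ⟨C, hC⟩ := hw.exists_le_nhds_one μ
  have : IsLocallyFiniteMeasure (weightedMeasure μ w) := by
    refine ⟨fun x => ?_⟩
    obtain ⟨K, hK, hKx⟩ := exists_compact_mem_nhds x
    have h1 : ∀ᶠ y in 𝓝 x, w (x⁻¹ * y) ≤ C := by
      have : Filter.Tendsto (fun y => x⁻¹ * y) (𝓝 x) (𝓝 1) := by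
        have := (continuous_const_mul x⁻¹).tendsto x
        rwa [inv_mul_cancel] at this
      exact this.eventually hC
    have h2 : ∀ᶠ y in 𝓝 x, w y ≤ w x * C := h1.mono fun y hy => by
      have h := hw.submul x (x⁻¹ * y)
      rw [mul_inv_cancel_left] at h
      exact h.trans (mul_le_mul_of_nonneg_left hy (hw.pos x).le)
    have hm : MeasurableSet ({y | w y ≤ w x * C} ∩ K) :=
      (measurableSet_le hw.measurable measurable_const).inter hK.isClosed.measurableSet
    refine ⟨{y | w y ≤ w x * C} ∩ K, Filter.inter_mem h2 hKx, ?_⟩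
    rw [weightedMeasure, withDensity_apply _ hm]
    calc ∫⁻ y in {y | w y ≤ w x * C} ∩ K, ENNReal.ofReal (w y) ∂μ
        ≤ ∫⁻ _ in {y | w y ≤ w x * C} ∩ K, ENNReal.ofReal (w x * C) ∂μ :=
          setLIntegral_mono' hm fun y hy => ENNReal.ofReal_le_ofReal hy.1
      _ = ENNReal.ofReal (w x * C) * μ ({y | w y ≤ w x * C} ∩ K) := setLIntegral_const _ _
      _ < ∞ := ENNReal.mul_lt_top ENNReal.ofReal_lt_top
          ((measure_mono Set.inter_subset_right).trans_lt hK.measure_lt_top)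
  infer_instance

/-- Since `χ(x / y) - 1 = (χ x - χ y) χ(y⁻¹)`, Steinhaus is applied to pieces on which `χ` varies
little and `χ(y⁻¹)` is controlled by `w y⁻¹`. Continuity at `1` then spreads by translation. -/
theorem WeightedDual.continuous {μ : Measure G} [μ.IsHaarMeasure] [μ.Regular] {w : G → ℝ}
    (hw : IsWeight w) (χ : WeightedDual μ w) : Continuous χ.1 := by
  have h1 : ContinuousAt χ.1 1 := by
    rw [Metric.continuousAt_iff']
    intro ε hε
    -- The radius depends on the bound `n` for `w y⁻¹`, so that `2 * δ n * n < ε`; the `+ 1` covers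
    -- `n = 0` and makes the inequality strict.
    let δ : ℕ → ℝ := fun n => ε / (2 * (n + 1))
    have hδ : ∀ n, 0 < δ n := fun n => by positivity
    obtain ⟨⟨n, k⟩, hn⟩ := exists_div_mem_nhds_one_of_iUnion_eq_univ μ
      (A := fun p : ℕ × ℕ => {x | w x⁻¹ ≤ p.1} ∩
        χ.1 ⁻¹' Metric.ball (TopologicalSpace.denseSeq ℂ p.2) (δ p.1))
      (fun p => (measurableSet_le (hw.measurable.comp measurable_inv) measurable_const).inter
        (χ.2.1 measurableSet_ball))
      (by
        refine Set.eq_univ_of_forall fun x => Set.mem_iUnion.mpr ?_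
        obtain ⟨n, hn⟩ := exists_nat_ge (w x⁻¹)
        obtain ⟨k, hk⟩ := (TopologicalSpace.denseRange_denseSeq ℂ).exists_dist_lt (χ.1 x) (hδ n)
        exact ⟨(n, k), hn, hk⟩)
    refine Filter.mem_of_superset hn ?_
    rintro _ ⟨x, hx, y, hy, rfl⟩
    have hy1 : χ.1 y * χ.1 y⁻¹ = 1 := by rw [← map_mul, mul_inv_cancel, map_one]
    have hxy : dist (χ.1 x) (χ.1 y) < 2 * δ n := by
      have := dist_triangle_right (χ.1 x) (χ.1 y) (TopologicalSpace.denseSeq ℂ k)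
      have h3 : dist (χ.1 x) (TopologicalSpace.denseSeq ℂ k) < δ n := hx.2
      have h4 : dist (χ.1 y) (TopologicalSpace.denseSeq ℂ k) < δ n := hy.2
      linarith
    have h5 : χ.1 (x / y) - χ.1 1 = (χ.1 x - χ.1 y) * χ.1 y⁻¹ := by
      rw [div_eq_mul_inv, map_mul, map_one, sub_mul, hy1]
    have h6 : ‖χ.1 y⁻¹‖ ≤ n := (χ.norm_le hw _).trans hy.1
    simp only [Set.mem_ofPred_eq]
    rw [dist_eq_norm, h5, norm_mul]
    rw [dist_eq_norm] at hxy
    calc ‖χ.1 x - χ.1 y‖ * ‖χ.1 y⁻¹‖ ≤ 2 * δ n * n := by gcongr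
      _ < 2 * δ n * (n + 1) := by have := hδ n; nlinarith
      _ = ε := by simp only [δ]; field_simp
  refine continuous_iff_continuousAt.mpr fun x => ?_
  have h2 : (χ.1 : G → ℂ) = fun y => χ.1 x * χ.1 (x⁻¹ * y) := by
    funext y
    rw [← map_mul, mul_inv_cancel_left]
  rw [h2]
  refine continuousAt_const.mul (ContinuousAt.comp (g := χ.1) ?_ (by fun_prop))
  rwa [inv_mul_cancel]

/-! ### Convolution of compactly supported continuous functions -/

section convolution

variable {𝕜 : Type*} [RCLike 𝕜] {f g : G → 𝕜}

theorem continuous_uncurry_mul_inv_mul (hf : Continuous f) (hg : Continuous g) :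
    Continuous (Function.uncurry fun x y : G => f y * g (y⁻¹ * x)) := by
  unfold Function.uncurry
  fun_prop

theorem hasCompactSupport_uncurry_mul_inv_mul (hf : HasCompactSupport f)
    (hg : HasCompactSupport g) :
    HasCompactSupport (Function.uncurry fun x y : G => f y * g (y⁻¹ * x)) := by
  refine HasCompactSupport.intro (K := (fun p : G × G => (p.1 * p.2, p.1)) ''
    (tsupport f ×ˢ tsupport g)) ((hf.prod hg).image (by fun_prop)) ?_
  rintro ⟨x, y⟩ hxy
  by_contra h
  refine hxy ⟨(y, y⁻¹ * x), ⟨subset_tsupport _ ?_, subset_tsupport _ ?_⟩, by simp⟩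
  · exact left_ne_zero_of_mul h
  · exact right_ne_zero_of_mul h

variable (μ : Measure G) [IsFiniteMeasureOnCompacts μ]

theorem continuous_integral_mul_inv_mul (hf : Continuous f) (hg : Continuous g)
    (hfc : HasCompactSupport f) : Continuous fun x => ∫ y, f y * g (y⁻¹ * x) ∂μ := by
  rw [← continuousOn_univ]
  refine continuousOn_integral_of_compact_support (k := tsupport f) hfc
    (continuous_uncurry_mul_inv_mul hf hg).continuousOn ?_
  intro x y _ hy
  simp only [image_eq_zero_of_notMem_tsupport hy, zero_mul]

theorem hasCompactSupport_integral_mul_inv_mul (hf : HasCompactSupport f)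
    (hg : HasCompactSupport g) : HasCompactSupport fun x => ∫ y, f y * g (y⁻¹ * x) ∂μ := by
  refine HasCompactSupport.intro (hf.isCompact.mul hg.isCompact) fun x hx => ?_
  refine integral_eq_zero_of_ae (.of_forall fun y => ?_)
  by_contra h
  refine hx ⟨y, subset_tsupport _ (left_ne_zero_of_mul h), y⁻¹ * x,
    subset_tsupport _ (right_ne_zero_of_mul h), by simp⟩

end convolution

end general

/-! ### Comparison of the weighted measure with Haar measure -/

section weightedMeasure

variable {G : Type u} [Group G] [MeasurableSpace G] {w : G → ℝ} (μ : Measure G)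

theorem integral_weightedMeasure {E : Type*} [NormedAddCommGroup E] [NormedSpace ℝ E]
    (hw : IsWeight w) (g : G → E) : ∫ x, g x ∂(weightedMeasure μ w) = ∫ x, w x • g x ∂μ := by
  unfold weightedMeasure
  rw [integral_withDensity_eq_integral_toReal_smul hw.measurable.ennreal_ofReal (by simp)]
  simp only [ENNReal.toReal_ofReal (hw.pos _).le]

theorem integrable_weightedMeasure_iff {E : Type*} [NormedAddCommGroup E] [NormedSpace ℝ E]
    (hw : IsWeight w) {g : G → E} :
    Integrable g (weightedMeasure μ w) ↔ Integrable (fun x => w x • g x) μ := by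
  unfold weightedMeasure
  rw [integrable_withDensity_iff_integrable_smul' hw.measurable.ennreal_ofReal (by simp)]
  simp only [ENNReal.toReal_ofReal (hw.pos _).le]

theorem weightedMeasure_absolutelyContinuous : weightedMeasure μ w ≪ μ :=
  withDensity_absolutelyContinuous _ _

theorem absolutelyContinuous_weightedMeasure (hw : IsWeight w) : μ ≪ weightedMeasure μ w :=
  withDensity_absolutelyContinuous' hw.measurable.ennreal_ofReal.aemeasurable
    (Filter.Eventually.of_forall fun x => by simpa using hw.pos x)

theorem isWeight_one : IsWeight (fun _ : G => (1 : ℝ)) :=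
  ⟨fun _ => one_pos, measurable_const, fun _ _ => by simp⟩

theorem weightedMeasure_one : weightedMeasure μ (fun _ : G => (1 : ℝ)) = μ := by
  simp [weightedMeasure]

end weightedMeasure

/-! ### Strict inequality for the norm of a convolution square -/

section

variable {G : Type u} [CommGroup G] [TopologicalSpace G] [IsTopologicalGroup G]
  [LocallyCompactSpace G] [T2Space G] [MeasurableSpace G] [BorelSpace G]
  (μ : Measure G) [μ.IsHaarMeasure] [μ.Regular] {w : G → ℝ} {f : G → ℂ}

theorem norm_groupConv_le (f g : G → ℂ) (x : G) :
    ‖groupConv μ f g x‖ ≤ ∫ y, ‖f y‖ * ‖g (y⁻¹ * x)‖ ∂μ := by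
  refine (norm_integral_le_integral_norm _).trans_eq ?_
  simp only [norm_mul]

/-- Substitute `x ↦ y * x` and use `w (y * x) ≤ w y * w x`. -/
theorem integral_norm_inv_mul_le (hw : IsWeight w)
    (hint : Integrable (fun x => ‖f x‖) (weightedMeasure μ w)) (y : G) :
    ∫ x, ‖f (y⁻¹ * x)‖ ∂(weightedMeasure μ w) ≤ w y * ∫ x, ‖f x‖ ∂(weightedMeasure μ w) := by
  have hint' := ((integrable_weightedMeasure_iff μ hw).mp hint).const_mul (w y)
  rw [integral_weightedMeasure μ hw fun x => ‖f (y⁻¹ * x)‖,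
    integral_weightedMeasure μ hw fun x => ‖f x‖,
    ← integral_mul_left_eq_self (fun x => w x • ‖f (y⁻¹ * x)‖) y, ← integral_const_mul]
  refine integral_mono_of_nonneg (Filter.Eventually.of_forall fun x => ?_) hint'
    (Filter.Eventually.of_forall fun x => ?_)
  · exact smul_nonneg (hw.pos _).le (norm_nonneg _)
  · simp only [inv_mul_cancel_left, smul_eq_mul]
    rw [← mul_assoc]
    exact mul_le_mul_of_nonneg_right (hw.submul _ _) (norm_nonneg _)

theorem integral_integral_norm_mul_norm_le (hw : IsWeight w) (hf : Continuous f)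
    (hfc : HasCompactSupport f) :
    ∫ x, ∫ y, ‖f y‖ * ‖f (y⁻¹ * x)‖ ∂μ ∂(weightedMeasure μ w) ≤
      (∫ x, ‖f x‖ ∂(weightedMeasure μ w)) ^ 2 := by
  have := hw.isFiniteMeasureOnCompacts μ
  have hint : Integrable (fun x => ‖f x‖) (weightedMeasure μ w) :=
    hf.norm.integrable_of_hasCompactSupport hfc.norm
  have hint' := (integrable_weightedMeasure_iff μ hw).mp hint
  have hinner := integral_norm_inv_mul_le μ hw hint
  have hM := integral_weightedMeasure μ hw fun x => ‖f x‖
  have hc : Continuous (Function.uncurry fun x y : G => ‖f y‖ * ‖f (y⁻¹ * x)‖) :=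
    continuous_uncurry_mul_inv_mul (f := fun x => ‖f x‖) (g := fun x => ‖f x‖) hf.norm hf.norm
  have hs : HasCompactSupport (Function.uncurry fun x y : G => ‖f y‖ * ‖f (y⁻¹ * x)‖) :=
    hasCompactSupport_uncurry_mul_inv_mul (f := fun x => ‖f x‖) (g := fun x => ‖f x‖)
      hfc.norm hfc.norm
  have hswap : ∫ x, ∫ y, ‖f y‖ * ‖f (y⁻¹ * x)‖ ∂μ ∂(weightedMeasure μ w) =
      ∫ y, ∫ x, ‖f y‖ * ‖f (y⁻¹ * x)‖ ∂(weightedMeasure μ w) ∂μ :=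
    integral_integral_swap_of_hasCompactSupport hc hs
  rw [hswap]
  simp only [integral_const_mul]
  generalize ∫ x, ‖f x‖ ∂(weightedMeasure μ w) = M at *
  have hpos : ∀ y, 0 ≤ ‖f y‖ * ∫ x, ‖f (y⁻¹ * x)‖ ∂(weightedMeasure μ w) := fun y =>
    mul_nonneg (norm_nonneg _) (integral_nonneg fun _ => norm_nonneg _)
  have hle : ∀ y, ‖f y‖ * ∫ x, ‖f (y⁻¹ * x)‖ ∂(weightedMeasure μ w) ≤ (w y • ‖f y‖) * M :=
    fun y => (mul_le_mul_of_nonneg_left (hinner y) (norm_nonneg _)).trans_eq (by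
      rw [smul_eq_mul]; ring)
  calc ∫ y, ‖f y‖ * ∫ x, ‖f (y⁻¹ * x)‖ ∂(weightedMeasure μ w) ∂μ
      ≤ ∫ y, (w y • ‖f y‖) * M ∂μ :=
        integral_mono_of_nonneg (Filter.Eventually.of_forall fun y => hpos y) (hint'.mul_const M)
          (Filter.Eventually.of_forall fun y => hle y)
    _ = M ^ 2 := by rw [integral_mul_const, ← hM, sq]

/-- If the phase of `f` is such that cancellation occurs in `(f ⋆ f)(1)`, then the norm of `f ⋆ f`
is less than the square of the norm of `f`. -/
theorem integral_norm_groupConv_lt (hw : IsWeight w) (hf : Continuous f)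
    (hfc : HasCompactSupport f)
    (h : ‖groupConv μ f f 1‖ < ∫ y, ‖f y‖ * ‖f (y⁻¹ * 1)‖ ∂μ) :
    ∫ x, ‖groupConv μ f f x‖ ∂(weightedMeasure μ w) <
      (∫ x, ‖f x‖ ∂(weightedMeasure μ w)) ^ 2 := by
  have := hw.isFiniteMeasureOnCompacts μ
  have : (weightedMeasure μ w).IsOpenPosMeasure :=
    (absolutelyContinuous_weightedMeasure μ hw).isOpenPosMeasure
  have hc1 : Continuous fun x => ‖groupConv μ f f x‖ :=
    (continuous_integral_mul_inv_mul μ hf hf hfc).norm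
  have hs1 : HasCompactSupport fun x => ‖groupConv μ f f x‖ :=
    (hasCompactSupport_integral_mul_inv_mul μ hfc hfc).norm
  have hc2 := continuous_integral_mul_inv_mul μ (f := fun x => ‖f x‖) (g := fun x => ‖f x‖)
    hf.norm hf.norm hfc.norm
  have hs2 := hasCompactSupport_integral_mul_inv_mul μ (f := fun x => ‖f x‖) (g := fun x => ‖f x‖)
    hfc.norm hfc.norm
  -- The nonnegative continuous function `|f| ⋆ |f| - |f ⋆ f|` is nonzero at `1`, and the weighted
  -- measure charges every nonempty open set.
  have hpos := (hc2.sub hc1).integral_pos_of_hasCompactSupport_nonneg_nonzero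
    (μ := weightedMeasure μ w) (hs2.sub hs1) (fun x => sub_nonneg.mpr (norm_groupConv_le μ f f x))
    (x := 1) (sub_pos.mpr h).ne'
  rw [integral_sub' (hc2.integrable_of_hasCompactSupport hs2)
    (hc1.integrable_of_hasCompactSupport hs1), sub_pos] at hpos
  exact hpos.trans_le (integral_integral_norm_mul_norm_le μ hw hf hfc)

omit [MeasurableSpace G] [BorelSpace G] in
theorem exists_even_pos_neg {a : G} (ha : a ≠ 1) : ∃ φ : G → ℝ, Continuous φ ∧
    HasCompactSupport φ ∧ (∀ x, φ x⁻¹ = φ x) ∧ 0 < φ 1 ∧ φ a < 0 := by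
  -- `p` must vanish at `a⁻¹` as well, since its symmetrization is evaluated at `a`. For `q`,
  -- nonnegativity at `a⁻¹` is enough, which also covers `a⁻¹ = a`.
  obtain ⟨p, hp1, hp0, hpc, hp⟩ := exists_continuous_one_zero_of_isCompact (X := G)
    (isCompact_singleton (x := 1)) (Set.toFinite {a, a⁻¹}).isClosed
    (by simp [ha.symm, eq_comm, ha])
  obtain ⟨q, hq1, hq0, hqc, hq⟩ := exists_continuous_one_zero_of_isCompact (X := G)
    (isCompact_singleton (x := a)) (isClosed_singleton (x := 1)) (by simpa using ha)
  have hinv : ∀ {r : G → ℝ}, HasCompactSupport r → HasCompactSupport fun x => r x⁻¹ :=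
    fun h => h.comp_homeomorph (Homeomorph.inv G)
  refine ⟨fun x => p x + p x⁻¹ - (q x + q x⁻¹), by fun_prop,
    (hpc.add (hinv hpc)).sub (hqc.add (hinv hqc)), fun x => ?_, ?_, ?_⟩
  · simp only [inv_inv]; ring
  · have h1 : p 1 = 1 := hp1 rfl
    have h2 : q 1 = 0 := hq0 rfl
    simp [h1, h2]
  · have h1 : p a = 0 := hp0 (by simp)
    have h2 : p a⁻¹ = 0 := hp0 (by simp)
    have h3 : q a = 1 := hq1 rfl
    have h4 := (hq a⁻¹).1
    simp only [h1, h2, h3]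
    linarith

-- Adding `φ * |φ|` to `|φ| * |φ|` leaves something positive at `b`; subtracting it leaves something
-- positive at `a`. Each gives one of the two strict bounds.
omit [T2Space G] [LocallyCompactSpace G] [IsTopologicalGroup G] [μ.IsHaarMeasure] [μ.Regular] in
theorem abs_integral_mul_abs_lt [IsFiniteMeasureOnCompacts μ] [μ.IsOpenPosMeasure] {φ : G → ℝ}
    (hφ : Continuous φ) (hφc : HasCompactSupport φ) {a b : G} (h1 : 0 < φ b) (hneg : φ a < 0) :
    |∫ x, φ x * |φ x| ∂μ| < ∫ x, |φ x| * |φ x| ∂μ := by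
  have hc1 : Continuous fun x => φ x * |φ x| := by fun_prop
  have hs1 : HasCompactSupport fun x => φ x * |φ x| := hφc.mul_right
  have hc2 : Continuous fun x => |φ x| * |φ x| := by fun_prop
  have hs2 : HasCompactSupport fun x => |φ x| * |φ x| := hφc.abs.mul_right
  have hi1 : Integrable (fun x => φ x * |φ x|) μ := hc1.integrable_of_hasCompactSupport hs1
  have hi2 : Integrable (fun x => |φ x| * |φ x|) μ := hc2.integrable_of_hasCompactSupport hs2
  rw [abs_lt]
  constructor
  · have hpos := (hc2.add hc1).integral_pos_of_hasCompactSupport_nonneg_nonzero (μ := μ)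
      (hs2.add hs1) (fun x => ?_) (x := b) ?_
    · rw [integral_add' hi2 hi1] at hpos
      linarith
    · have h2 := neg_abs_le (φ x)
      have h3 := abs_nonneg (φ x)
      simp only [Pi.zero_apply, Pi.add_apply]
      nlinarith
    · simp only [Pi.add_apply, abs_of_pos h1]
      positivity
  · have hpos := (hc2.sub hc1).integral_pos_of_hasCompactSupport_nonneg_nonzero (μ := μ)
      (hs2.sub hs1) (fun x => ?_) (x := a) ?_
    · rw [integral_sub' hi2 hi1] at hpos
      linarith
    · have h2 := le_abs_self (φ x)
      have h3 := abs_nonneg (φ x)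
      simp only [Pi.zero_apply, Pi.sub_apply]
      nlinarith
    · simp only [Pi.sub_apply, abs_of_neg hneg]
      have := mul_pos_of_neg_of_neg hneg hneg
      nlinarith

theorem exists_integral_norm_groupConv_lt [Nontrivial G] (hw : IsWeight w) :
    ∃ f : G → ℂ, Continuous f ∧ HasCompactSupport f ∧
      ∫ x, ‖groupConv μ f f x‖ ∂(weightedMeasure μ w) <
        (∫ x, ‖f x‖ ∂(weightedMeasure μ w)) ^ 2 := by
  obtain ⟨a, ha⟩ := exists_ne (1 : G)
  obtain ⟨φ, hφ, hφc, heven, h1, hneg⟩ := exists_even_pos_neg ha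
  -- `F` fixes the positive half-line and sends `t < 0` to `|t| * I`: the modulus is `|t|`, but the
  -- square is `t * |t|`, which keeps the sign of `t`. As `φ` is even, `(f ⋆ f)(1)` becomes `∫ φ *
  -- |φ|`.
  let F : ℝ → ℂ := fun t => ((max t 0 : ℝ) : ℂ) + ((max (-t) 0 : ℝ) : ℂ) * Complex.I
  have hF : Continuous F := by fun_prop
  have hF0 : F 0 = 0 := by simp [F]
  have hFn : ∀ t, ‖F t‖ = |t| := by
    intro t
    rcases le_total 0 t with ht | ht
    · simp [F, ht, abs_of_nonneg]
    · simp [F, ht, abs_of_nonpos]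
  have hFs : ∀ t, F t * F t = ((t * |t| : ℝ) : ℂ) := by
    intro t
    rcases le_total 0 t with ht | ht
    · simp [F, ht, abs_of_nonneg]
    · simp only [F, max_eq_right ht, max_eq_left (neg_nonneg.mpr ht), abs_of_nonpos ht]
      push_cast
      linear_combination (t : ℂ) * t * Complex.I_mul_I
  have hFφ : Continuous fun x => F (φ x) := hF.comp hφ
  have hFφc : HasCompactSupport fun x => F (φ x) := hφc.comp_left hF0
  refine ⟨fun x => F (φ x), hFφ, hFφc, integral_norm_groupConv_lt μ hw hFφ hFφc ?_⟩
  have e1 : groupConv μ (fun x => F (φ x)) (fun x => F (φ x)) 1 =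
      ((∫ x, φ x * |φ x| ∂μ : ℝ) : ℂ) := by
    simp only [groupConv, mul_one, heven, hFs]
    exact integral_ofReal
  rw [e1, Complex.norm_real, Real.norm_eq_abs]
  simp only [mul_one, heven, hFn]
  exact abs_integral_mul_abs_lt μ hφ hφc h1 hneg

/-- Fubini and the substitution `x ↦ y * x`; continuity of `χ` keeps the integrand in the compactly
supported continuous case. -/
theorem fourierAt_groupConv_self {χ : G → ℂ} (hχ : Continuous χ)
    (hmul : ∀ x y, χ (x * y) = χ x * χ y) (hf : Continuous f) (hfc : HasCompactSupport f) :
    fourierAt μ (groupConv μ f f) χ = fourierAt μ f χ ^ 2 := by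
  have hc : Continuous (Function.uncurry fun x y : G => conj (χ x) * (f y * f (y⁻¹ * x))) :=
    (Complex.continuous_conj.comp (hχ.comp continuous_fst)).mul
      (continuous_uncurry_mul_inv_mul hf hf)
  have hs : HasCompactSupport
      (Function.uncurry fun x y : G => conj (χ x) * (f y * f (y⁻¹ * x))) :=
    (hasCompactSupport_uncurry_mul_inv_mul hfc hfc).mul_left
  unfold fourierAt groupConv
  simp only [← integral_const_mul]
  rw [integral_integral_swap_of_hasCompactSupport hc hs, sq, ← integral_mul_const]
  congr 1
  funext y
  rw [← integral_mul_left_eq_self _ y, ← integral_const_mul]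
  congr 1
  funext x
  rw [inv_mul_cancel_left, hmul, map_mul]
  ring

theorem norm_fourierAt_le_integral (hw : IsWeight w) {χ : G → ℂ} (hχ : ∀ x, ‖χ x‖ ≤ w x)
    (hf : Continuous f) (hfc : HasCompactSupport f) :
    ‖fourierAt μ f χ‖ ≤ ∫ x, ‖f x‖ ∂(weightedMeasure μ w) := by
  have := hw.isFiniteMeasureOnCompacts μ
  have hint : Integrable (fun x => ‖f x‖) (weightedMeasure μ w) :=
    hf.norm.integrable_of_hasCompactSupport hfc.norm
  rw [integral_weightedMeasure μ hw]
  refine norm_integral_le_of_norm_le ((integrable_weightedMeasure_iff μ hw).mp hint)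
    (Filter.Eventually.of_forall fun x => ?_)
  rw [norm_mul, RCLike.norm_conj]
  exact mul_le_mul_of_nonneg_right (hχ x) (norm_nonneg _)

theorem norm_fourierAt_sq_le (hw : IsWeight w) {χ : G → ℂ} (hχ : Continuous χ)
    (hmul : ∀ x y, χ (x * y) = χ x * χ y) (hχw : ∀ x, ‖χ x‖ ≤ w x)
    (hf : Continuous f) (hfc : HasCompactSupport f) :
    ‖fourierAt μ f χ‖ ^ 2 ≤ ∫ x, ‖groupConv μ f f x‖ ∂(weightedMeasure μ w) := by
  rw [← norm_pow, ← fourierAt_groupConv_self μ hχ hmul hf hfc]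
  exact norm_fourierAt_le_integral μ hw hχw (continuous_integral_mul_inv_mul μ hf hf hfc)
    (hasCompactSupport_integral_mul_inv_mul μ hfc hfc)

end

/-! ### Each analytic condition forces the group to be trivial -/

section

variable {G : Type u} [CommGroup G] [TopologicalSpace G] [IsTopologicalGroup G]
  [LocallyCompactSpace G] [T2Space G] [MeasurableSpace G] [BorelSpace G]
  (μ : Measure G) [μ.IsHaarMeasure] [μ.Regular] {w : G → ℝ}

theorem fourierAt_congr {f g : G → ℂ} (h : f =ᵐ[μ] g) (χ : G → ℂ) :
    fourierAt μ f χ = fourierAt μ g χ :=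
  integral_congr_ae (h.mono fun x hx => by simp only [hx])

theorem groupConv_congr {f f' g g' : G → ℂ} (hf : f =ᵐ[μ] f') (hg : g =ᵐ[μ] g') :
    groupConv μ f g = groupConv μ f' g' := by
  funext x
  have h : ∀ᵐ y ∂μ, g (y⁻¹ * x) = g' (y⁻¹ * x) := by
    simp only [mul_comm _ x]
    exact ((measurePreserving_mul_left μ x).comp
      (Measure.measurePreserving_inv μ)).quasiMeasurePreserving.ae_eq_comp hg
  refine integral_congr_ae ?_
  filter_upwards [hf, h] with y h1 h2
  simp only [h1, h2]

theorem groupConv_comm (f g : G → ℂ) : groupConv μ f g = groupConv μ g f := by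
  funext x
  unfold groupConv
  rw [← integral_div_left_eq_self _ μ x]
  congr 1
  funext y
  rw [mul_comm, div_eq_mul_inv, mul_inv_rev, inv_inv, inv_mul_cancel_right, mul_comm x]

/-- The map is not bundled as linear, so its value at `0` is computed to pass from distances to
norms. -/
theorem norm_weightedGelfandMap (hw : IsWeight w)
    (hΓ : Isometry (weightedGelfandMap μ w hw)) (f : WeightedL1 μ w) :
    ‖f‖ = ‖weightedGelfandMap μ w hw f‖ := by
  have h0 : weightedGelfandMap μ w hw 0 = 0 := by
    ext χ
    have h : ((0 : WeightedL1 μ w) : G → ℂ) =ᵐ[μ] 0 :=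
      (absolutelyContinuous_weightedMeasure μ hw).ae_eq (Lp.coeFn_zero _ _ _)
    exact (fourierAt_congr μ h _).trans (by simp [fourierAt])
  rw [← dist_zero_right f, ← hΓ.dist_eq, h0, dist_zero_right]

theorem norm_gelfandMap (hΓ : Isometry (gelfandMap μ)) (f : Lp ℂ 1 μ) :
    ‖f‖ = ‖gelfandMap μ f‖ := by
  have h0 : gelfandMap μ 0 = 0 := by
    ext χ
    exact (fourierAt_congr μ (Lp.coeFn_zero ℂ 1 μ) _).trans (by simp [fourierAt])
  rw [← dist_zero_right f, ← hΓ.dist_eq, h0, dist_zero_right]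

theorem subsingleton_of_forall_sq_le (hw : IsWeight w)
    (h : ∀ f : G → ℂ, Continuous f → HasCompactSupport f →
      (∫ x, ‖f x‖ ∂(weightedMeasure μ w)) ^ 2 ≤
        ∫ x, ‖groupConv μ f f x‖ ∂(weightedMeasure μ w)) : Subsingleton G := by
  by_contra hG
  have := not_subsingleton_iff_nontrivial.mp hG
  obtain ⟨f, hf, hfc, hlt⟩ := exists_integral_norm_groupConv_lt μ hw
  exact (h f hf hfc).not_gt hlt

theorem exists_lp_coeFn_ae_eq {ν : Measure G} [IsFiniteMeasureOnCompacts ν] {f : G → ℂ}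
    (hf : Continuous f) (hfc : HasCompactSupport f) :
    ∃ F : Lp ℂ 1 ν, F =ᵐ[ν] f ∧ ‖F‖ = ∫ x, ‖f x‖ ∂ν := by
  have hint : Integrable f ν := hf.integrable_of_hasCompactSupport hfc
  exact ⟨hint.toL1 f, hint.coeFn_toL1, L1.norm_of_fun_eq_integral_norm hint⟩

theorem subsingleton_of_isometry_weightedGelfandMap (hw : IsWeight w)
    (hΓ : Isometry (weightedGelfandMap μ w hw)) : Subsingleton G := by
  refine subsingleton_of_forall_sq_le μ hw fun f hf hfc => ?_
  have := hw.isFiniteMeasureOnCompacts μ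
  obtain ⟨F, hF, hFn⟩ := exists_lp_coeFn_ae_eq (ν := weightedMeasure μ w) hf hfc
  have hF' := (absolutelyContinuous_weightedMeasure μ hw).ae_eq hF
  have hnn : 0 ≤ ∫ x, ‖groupConv μ f f x‖ ∂(weightedMeasure μ w) :=
    integral_nonneg fun _ => norm_nonneg _
  -- Taking square roots turns the claim into a bound on a supremum norm, which can be checked one
  -- `χ` at a time.
  rw [← hFn, norm_weightedGelfandMap μ hw hΓ F, ← Real.le_sqrt (norm_nonneg _) hnn,
    BoundedContinuousFunction.norm_le (Real.sqrt_nonneg _)]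
  intro χ
  rw [Real.le_sqrt (norm_nonneg _) hnn]
  change ‖fourierAt μ F χ.1‖ ^ 2 ≤ _
  rw [fourierAt_congr μ hF']
  exact norm_fourierAt_sq_le μ hw (χ.continuous hw) (map_mul χ.1) (χ.norm_le hw) hf hfc

theorem subsingleton_of_isometry_gelfandMap (hΓ : Isometry (gelfandMap μ)) :
    Subsingleton G := by
  refine subsingleton_of_forall_sq_le μ isWeight_one fun f hf hfc => ?_
  rw [weightedMeasure_one]
  obtain ⟨F, hF, hFn⟩ := exists_lp_coeFn_ae_eq (ν := μ) hf hfc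
  have hnn : 0 ≤ ∫ x, ‖groupConv μ f f x‖ ∂μ := integral_nonneg fun _ => norm_nonneg _
  rw [← hFn, norm_gelfandMap μ hΓ F, ← Real.le_sqrt (norm_nonneg _) hnn,
    BoundedContinuousFunction.norm_le (Real.sqrt_nonneg _)]
  intro γ
  rw [Real.le_sqrt (norm_nonneg _) hnn]
  change ‖fourierAt μ F (dualFun γ)‖ ^ 2 ≤ _
  rw [fourierAt_congr μ hF, ← norm_pow,
    ← fourierAt_groupConv_self μ (continuous_dualFun γ) (fun x y => by simp [dualFun]) hf hfc]
  exact norm_fourierAt_dual_le μ _ γ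

/-- By normality `(b * b)⋆ (b * b) = (b⋆ b)⋆ (b⋆ b)`; the C⋆-identity for `b * b`, `b⋆ b` and `b`
gives `‖b * b‖ ^ 2 = ‖b‖ ^ 4`. -/
theorem norm_mul_self_of_isStarNormal {B : Type*} [NonUnitalNormedRing B] [StarRing B]
    [CStarRing B] (b : B) [IsStarNormal b] : ‖b * b‖ = ‖b‖ ^ 2 := by
  have hb : star b * b = b * star b := star_comm_self' b
  have h1 : star (b * b) * (b * b) = star (star b * b) * (star b * b) := by
    simp only [star_mul, star_star, mul_assoc]
    rw [← mul_assoc (star b) b b, hb, mul_assoc, ← hb]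
  have h2 : ‖b * b‖ * ‖b * b‖ = (‖b‖ ^ 2) * (‖b‖ ^ 2) := by
    rw [← CStarRing.norm_star_mul_self, h1, CStarRing.norm_star_mul_self,
      CStarRing.norm_star_mul_self, sq]
  exact (mul_self_inj (norm_nonneg _) (by positivity)).mp h2

theorem subsingleton_of_isCStarUnderConv (hw : IsWeight w)
    (h : IsCStarUnderConv μ (weightedMeasure μ w)) : Subsingleton G := by
  refine subsingleton_of_forall_sq_le μ hw fun f hf hfc => ?_
  have := hw.isFiniteMeasureOnCompacts μ
  obtain ⟨B, _, e, he⟩ := h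
  -- Convolution on an abelian group is commutative, so `B` is too, and each of its elements is
  -- normal for whichever involution it carries.
  have hcomm : ∀ a b : B, a * b = b * a := by
    intro a b
    refine e.symm.injective (Lp.ext ?_)
    refine (weightedMeasure_absolutelyContinuous μ).ae_eq ?_
    have h1 := he (e.symm a) (e.symm b)
    have h2 := he (e.symm b) (e.symm a)
    rw [groupConv_comm] at h1
    simp only [LinearIsometryEquiv.apply_symm_apply] at h1 h2
    exact h1.trans h2.symm
  obtain ⟨F, hF, hFn⟩ := exists_lp_coeFn_ae_eq (ν := weightedMeasure μ w) hf hfc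
  have hF' := (absolutelyContinuous_weightedMeasure μ hw).ae_eq hF
  have : IsStarNormal (e F) := ⟨hcomm _ _⟩
  have h1 := he F F
  rw [groupConv_congr μ hF' hF'] at h1
  have h2 := (weightedMeasure_absolutelyContinuous (w := w) μ).ae_eq h1
  rw [← hFn, ← e.norm_map F, ← norm_mul_self_of_isStarNormal, ← e.symm.norm_map,
    L1.norm_eq_integral_norm]
  exact (integral_congr_ae (h2.mono fun x hx => by simp only [hx])).le

end

/-! ### The trivial group satisfies all conditions -/

section trivial

variable {G : Type u} [CommGroup G] [TopologicalSpace G] [IsTopologicalGroup G]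
  [LocallyCompactSpace G] [T2Space G] [MeasurableSpace G] [BorelSpace G]
  (μ : Measure G) [μ.IsHaarMeasure] [μ.Regular]

theorem integral_of_subsingleton {E : Type*} [NormedAddCommGroup E] [NormedSpace ℝ E]
    [CompleteSpace E] [Subsingleton G] (f : G → E) : ∫ x, f x ∂μ = μ.real Set.univ • f 1 := by
  rw [← integral_const]
  congr 1
  funext x
  rw [Subsingleton.elim x 1]

theorem norm_integral_of_subsingleton [Subsingleton G] (f : G → ℂ) :
    ‖∫ x, f x ∂μ‖ = ∫ x, ‖f x‖ ∂μ := by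
  rw [integral_of_subsingleton, integral_of_subsingleton, norm_smul, smul_eq_mul,
    Real.norm_of_nonneg measureReal_nonneg]

/-- Over the trivial group, integration is a linear isometry of `L¹` into the scalars. -/
theorem dist_integral_of_subsingleton [Subsingleton G] (f g : Lp ℂ 1 μ) :
    dist (∫ x, f x ∂μ) (∫ x, g x ∂μ) = dist f g := by
  rw [dist_eq_norm, dist_eq_norm, ← integral_sub (L1.integrable_coeFn f) (L1.integrable_coeFn g),
    norm_integral_of_subsingleton, L1.norm_eq_integral_norm]
  exact integral_congr_ae ((Lp.coeFn_sub f g).mono fun x hx => by simp only [hx, Pi.sub_apply])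

theorem fourierAt_of_subsingleton [Subsingleton G] (f : G → ℂ) {χ : G → ℂ} (hχ : χ 1 = 1) :
    fourierAt μ f χ = ∫ x, f x ∂μ := by
  unfold fourierAt
  congr 1
  funext x
  rw [Subsingleton.elim x 1, hχ, map_one, one_mul]

theorem isometry_gelfandMap_of_subsingleton [Subsingleton G] : Isometry (gelfandMap μ) := by
  refine Isometry.of_dist_eq fun f g => ?_
  have h : ∀ (f : Lp ℂ 1 μ) (γ : PontryaginDual G), gelfandMap μ f γ = ∫ x, f x ∂μ := fun f γ =>
    fourierAt_of_subsingleton μ f (by simp [dualFun])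
  rw [← dist_integral_of_subsingleton]
  refine le_antisymm ((BoundedContinuousFunction.dist_le dist_nonneg).mpr fun γ => ?_) ?_
  · rw [h, h]
  · rw [← h f 1, ← h g 1]
    exact BoundedContinuousFunction.dist_coe_le_dist _

theorem isometry_weightedGelfandMap_of_subsingleton [Subsingleton G] {w : G → ℝ}
    (hw : IsWeight w) (hw1 : w 1 = 1) : Isometry (weightedGelfandMap μ w hw) := by
  obtain rfl : w = fun _ => 1 := by
    funext x
    rw [Subsingleton.elim x 1, hw1]
  refine Isometry.of_dist_eq fun f g => ?_
  have h : ∀ (f : WeightedL1 μ fun _ => (1 : ℝ)) (χ : WeightedDual μ fun _ => (1 : ℝ)),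
      weightedGelfandMap μ _ hw f χ = ∫ x, f x ∂(weightedMeasure μ fun _ => (1 : ℝ)) := by
    intro f χ
    have hν : ∀ F : G → ℂ, ∫ x, F x ∂μ = ∫ x, F x ∂(weightedMeasure μ fun _ => (1 : ℝ)) := by
      simp [weightedMeasure_one]
    exact (fourierAt_of_subsingleton μ f (map_one χ.1)).trans (hν f)
  have : (weightedMeasure μ fun _ => (1 : ℝ)).IsHaarMeasure := by
    rwa [weightedMeasure_one]
  rw [← dist_integral_of_subsingleton]
  refine le_antisymm ((BoundedContinuousFunction.dist_le dist_nonneg).mpr fun χ => ?_) ?_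
  · rw [h, h]
  -- The trivial character shows that the supremum is attained and not taken over an empty set.
  · let χ : WeightedDual μ fun _ => (1 : ℝ) := ⟨1, measurable_const, 1, by simp⟩
    rw [← h f χ, ← h g χ]
    exact BoundedContinuousFunction.dist_coe_le_dist _

/-- With total mass `c`, the norm is `c * |f 1|` and `(f ⋆ g)(1) = c * f 1 * g 1`, so `f ↦ c * f 1 =
∫ f` is isometric and multiplicative for every `c > 0`. The target `C(G, ℂ)` is a copy of `ℂ` in the
universe of `G`. -/
theorem isCStarUnderConv_of_subsingleton [Subsingleton G] : IsCStarUnderConv μ μ := by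
  have : Finite G := inferInstance
  let I : Lp ℂ 1 μ →ₗᵢ[ℂ] C(G, ℂ) :=
    { toFun := fun f => ContinuousMap.const G (∫ x, f x ∂μ)
      map_add' := fun f g => by
        ext
        simp only [ContinuousMap.const_apply, ContinuousMap.add_apply]
        rw [← integral_add (L1.integrable_coeFn f) (L1.integrable_coeFn g)]
        exact integral_congr_ae (Lp.coeFn_add f g)
      map_smul' := fun c f => by
        ext
        simp only [ContinuousMap.const_apply, ContinuousMap.smul_apply, RingHom.id_apply]
        rw [← integral_smul]
        exact integral_congr_ae (Lp.coeFn_smul c f)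
      norm_map' := fun f => by
        change ‖ContinuousMap.const G (∫ x, f x ∂μ)‖ = _
        simp only [ContinuousMap.norm_eq_iSup_norm, ContinuousMap.const_apply, ciSup_const]
        rw [norm_integral_of_subsingleton, L1.norm_eq_integral_norm] }
  have hI : ∀ f x, I f x = ∫ x, f x ∂μ := fun _ _ => rfl
  have hμ : μ.real Set.univ ≠ 0 := by
    have : IsFiniteMeasure μ := inferInstance
    exact (measureReal_univ_pos).ne'
  have hsurj : Function.Surjective I := by
    intro c
    have hint : Integrable (fun _ : G => ((μ.real Set.univ)⁻¹ : ℝ) • c 1) μ := integrable_const _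
    refine ⟨hint.toL1 _, ?_⟩
    ext x
    rw [hI, integral_congr_ae hint.coeFn_toL1, integral_of_subsingleton, smul_smul,
      mul_inv_cancel₀ hμ, one_smul, Subsingleton.elim x 1]
  refine ⟨C(G, ℂ), inferInstance, LinearIsometryEquiv.ofSurjective I hsurj, fun f g => ?_⟩
  set e := LinearIsometryEquiv.ofSurjective I hsurj
  have h : I (e.symm (e f * e g)) 1 = I f 1 * I g 1 := by
    change e (e.symm (e f * e g)) 1 = _
    rw [e.apply_symm_apply]
    rfl
  rw [hI, hI, hI, integral_of_subsingleton, integral_of_subsingleton,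
    integral_of_subsingleton] at h
  refine Filter.Eventually.of_forall fun x => ?_
  rw [Subsingleton.elim x 1, groupConv, integral_of_subsingleton]
  refine smul_right_injective ℂ hμ (h.trans ?_)
  simp only [inv_one, mul_one, Complex.real_smul]
  ring

end trivial

theorem mainTheorem4 {G : Type u} [CommGroup G] [TopologicalSpace G] [IsTopologicalGroup G]
    [LocallyCompactSpace G] [T2Space G] [MeasurableSpace G] [BorelSpace G]
    (μ : Measure G) [μ.IsHaarMeasure] [μ.Regular]
    (w : G → ℝ) (hw : IsWeight w) (hw1 : Subsingleton G → w 1 = 1) :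
    List.TFAE [
      Isometry (weightedGelfandMap μ w hw),
      Isometry (gelfandMap μ),
      IsCStarUnderConv μ (weightedMeasure μ w),
      IsCStarUnderConv μ μ,
      Subsingleton G] := by
  tfae_have 1 → 5 := subsingleton_of_isometry_weightedGelfandMap μ hw
  tfae_have 2 → 5 := subsingleton_of_isometry_gelfandMap μ
  tfae_have 3 → 5 := subsingleton_of_isCStarUnderConv μ hw
  tfae_have 4 → 5 := fun h => subsingleton_of_isCStarUnderConv μ isWeight_one
    (by rwa [weightedMeasure_one])
  tfae_have 5 → 1 := fun h => isometry_weightedGelfandMap_of_subsingleton μ hw (hw1 h)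
  tfae_have 5 → 2 := fun _ => isometry_gelfandMap_of_subsingleton μ
  tfae_have 5 → 4 := fun _ => isCStarUnderConv_of_subsingleton μ
  tfae_have 5 → 3 := fun h => by
    obtain rfl : w = fun _ => 1 := by
      funext x
      rw [Subsingleton.elim x 1, hw1 h]
    rw [weightedMeasure_one]
    exact isCStarUnderConv_of_subsingleton μ
  tfae_finish
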